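/- Let $d\ge 2$ and let $A\in\mathbb R^{d\times d}$ be a symmetric positive definite matrix. Let $$\omega_d=\frac{2\pi^{d/2}}{\Gamma(d/2)},$$ which is the surface area of the unit sphere in $\mathbb R^d$. For $\xi,\eta\in\mathbb R^d$ with $\xi\ne\eta$ put $$G_A(\xi,\eta)=\begin{cases}\dfrac{1}{2\pi\sqrt{\det A}}\,\log\sqrt{(\xi-\eta)^{\top}A^{-1}(\xi-\eta)}, & d=2,\\[2mm] -\dfrac{1}{(d-2)\,\omega_d\sqrt{\det A}}\,\big[(\xi-\eta)^{\top}A^{-1}(\xi-\eta)\big]^{\frac{2-d}{2}}, & d\ge 3.\end{cases}$$ Then $G_A$ is a fundamental solution of the anisotropic Laplacian: for every $\eta\in\mathbb R^d$ the function $\xi\mapsto G_A(\xi,\eta)$ is locally integrable on $\mathbb R^d$, and $$\nabla_\xi\cdot\big(A\,\nabla_\xi G_A(\xi,\eta)\big)=\delta(\xi-\eta)$$ in the sense of distributions on $\mathbb R^d$, where $\delta(\xi-\eta)$ is the Dirac delta distribution at $\eta$; that is, $\int_{\mathbb R^d}G_A(\xi,\eta)\,\nabla\cdot(A\nabla\varphi)(\xi)\,d\xi=\varphi(\eta)$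 for every $\varphi\in C_c^\infty(\mathbb R^d)$. -/

import Mathlib

open MeasureTheory
open scoped Distributions LineDeriv Matrix

noncomputable section

/-- The surface area `ω_d` of the unit sphere of the Euclidean space `ℝ^d`: the total mass of the
surface measure that Lebesgue measure induces on the unit sphere (polar coordinates). -/
def unitSphereArea (d : ℕ) : ℝ :=
  (volume : Measure (EuclideanSpace ℝ (Fin d))).toSphere.real Set.univ

/-- The quadratic form `vᵀ A⁻¹ v`. -/
def invQuadForm {d : ℕ} (A : Matrix (Fin d) (Fin d) ℝ) (v : EuclideanSpace ℝ (Fin d)) : ℝ :=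
  v.ofLp ⬝ᵥ (A⁻¹ *ᵥ v.ofLp)

/-- The function `G_A(ξ, η)`, given by the logarithmic formula for `d = 2` and by the power formula
in the other dimensions (which are `d ≥ 3` wherever it is used). -/
def anisotropicGreen {d : ℕ} (A : Matrix (Fin d) (Fin d) ℝ) (ξ η : EuclideanSpace ℝ (Fin d)) : ℝ :=
  if d = 2 then
    1 / (2 * Real.pi * √A.det) * Real.log (√(invQuadForm A (ξ - η)))
  else
    -(1 / (((d : ℝ) - 2) * unitSphereArea d * √A.det)) *
      invQuadForm A (ξ - η) ^ ((2 - (d : ℝ)) / 2)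

/-- The regular distribution `φ ↦ ∫ φ(ξ) f(ξ) dξ` on `ℝ^d` defined by a locally integrable
function `f`. -/
def regularDistribution {d : ℕ} (f : EuclideanSpace ℝ (Fin d) → ℝ) :
    𝓓'((⊤ : TopologicalSpace.Opens (EuclideanSpace ℝ (Fin d))), ℝ) :=
  TestFunction.integralAgainstBilinCLM (ContinuousLinearMap.mul ℝ ℝ) volume f

/-- The anisotropic Laplacian `∇·(A∇T) = ∑ᵢ ∂ᵢ (∑ⱼ Aᵢⱼ ∂ⱼ T)` of a distribution `T` on `ℝ^d`. -/
def anisotropicLaplacian {d : ℕ} (A : Matrix (Fin d) (Fin d) ℝ)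
    (T : 𝓓'((⊤ : TopologicalSpace.Opens (EuclideanSpace ℝ (Fin d))), ℝ)) :
    𝓓'((⊤ : TopologicalSpace.Opens (EuclideanSpace ℝ (Fin d))), ℝ) :=
  ∑ i : Fin d, ∂_{EuclideanSpace.single i (1 : ℝ)}
    (∑ j : Fin d, A i j • ∂_{EuclideanSpace.single j (1 : ℝ)} T)

end

/-! Write `A = C * Cᵀ`. The substitution `ξ = C y + η` turns `∇·(A∇)` into the Laplacian and the
quadratic form `(ξ - η)ᵀ A⁻¹ (ξ - η)` into `‖y‖²`, at the cost of the Jacobian `|det C| = √(det A)`,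
so only the isotropic case at the origin is left. There the singular kernel is replaced by its
profile at `‖y‖² + ε`, which is smooth and has gradient `(‖y‖² + ε) ^ (-n / 2) • y`. Green's
identity moves one derivative off the test function `ψ`, and as `ε → 0` the integral becomes
`-∫ ‖y‖ ^ (-n) ∂_y ψ(y) dy`. In polar coordinates the weight cancels against the radial density, and
the fundamental theorem of calculus along each ray gives `ψ 0` times the area of the sphere. -/

open Metric Module Set Filter Topology

theorem unitSphereArea_eq {d : ℕ} (hd : d ≠ 0) :
    unitSphereArea d = 2 * Real.pi ^ ((d : ℝ) / 2) / Real.Gamma ((d : ℝ) / 2) := by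
  have : NeZero d := ⟨hd⟩
  have hd2 : (0 : ℝ) < d / 2 := by positivity
  rw [unitSphereArea, Measure.toSphere_real_apply_univ, measureReal_def,
    EuclideanSpace.volume_ball, Real.Gamma_add_one (by simpa using hd2.ne')]
  simp only [finrank_euclideanSpace, Fintype.card_fin, ENNReal.ofReal_one, one_pow, one_mul]
  rw [ENNReal.toReal_ofReal (by have := Real.Gamma_pos_of_pos hd2; positivity),
    Real.sqrt_eq_rpow, ← Real.rpow_natCast, ← Real.rpow_mul Real.pi_pos.le,
    one_div_mul_eq_div]
  field_simp

theorem unitSphereArea_pos {d : ℕ} (hd : d ≠ 0) : 0 < unitSphereArea d := by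
  have := Real.Gamma_pos_of_pos (s := (d : ℝ) / 2) (by positivity)
  rw [unitSphereArea_eq hd]
  positivity

section PolarCoordinates

variable {E F : Type*} [NormedAddCommGroup E] [NormedSpace ℝ E] [FiniteDimensional ℝ E]
  [MeasurableSpace E] [BorelSpace E] (μ : Measure E) [μ.IsAddHaarMeasure]
  [NormedAddCommGroup F] [NormedSpace ℝ F]

theorem integral_volumeIoiPow (n : ℕ) (f : ℝ → F) :
    ∫ r, f r ∂(Measure.volumeIoiPow n) = ∫ r in Ioi (0 : ℝ), r ^ n • f r := by
  simp only [Measure.volumeIoiPow, ENNReal.ofReal]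
  rw [integral_withDensity_eq_integral_smul (by fun_prop),
    integral_subtype_comap measurableSet_Ioi fun r : ℝ ↦ Real.toNNReal (r ^ n) • f r]
  refine setIntegral_congr_fun measurableSet_Ioi fun r (hr : 0 < r) ↦ ?_
  simp only [NNReal.smul_def, Real.coe_toNNReal _ (pow_nonneg hr.le n)]

variable {μ} in
theorem integral_eq_integral_toSphere_integral_Ioi [Nontrivial E] {f : E → F}
    (hf : Integrable f μ) :
    ∫ x, f x ∂μ =
      ∫ ω : sphere (0 : E) 1, (∫ r in Ioi (0 : ℝ), r ^ (finrank ℝ E - 1) • f (r • ω.1))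
        ∂μ.toSphere := by
  let g : sphere (0 : E) 1 × Ioi (0 : ℝ) → F := fun p ↦ f (p.2.1 • p.1.1)
  have hmp := μ.measurePreserving_homeomorphUnitSphereProd
  have hemb := (homeomorphUnitSphereProd E).measurableEmbedding
  have hgf (x : ({0}ᶜ : Set E)) : g (homeomorphUnitSphereProd E x) = f x := by
    simp [g, smul_smul, norm_ne_zero_iff.2 x.2]
  have hg : Integrable g (μ.toSphere.prod (.volumeIoiPow (finrank ℝ E - 1))) := by
    rw [← restrict_compl_singleton (μ := μ) 0, ← IntegrableOn,
      integrableOn_iff_comap_subtypeVal (measurableSet_singleton _).compl] at hf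
    rw [← hmp.integrable_comp_emb hemb]
    exact hf.congr (.of_forall fun x ↦ (hgf x).symm)
  calc ∫ x, f x ∂μ = ∫ x : ({0}ᶜ : Set E), f x ∂(μ.comap (↑)) := by
        rw [integral_subtype_comap (measurableSet_singleton _).compl f, restrict_compl_singleton]
    _ = ∫ p, g p ∂(μ.toSphere.prod (.volumeIoiPow (finrank ℝ E - 1))) := by
        simp only [← hmp.integral_comp hemb g, hgf]
    _ = _ := by
        rw [integral_prod g hg]
        exact integral_congr_ae (.of_forall fun ω ↦
          integral_volumeIoiPow _ fun r : ℝ ↦ f (r • ω.1))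

theorem locallyIntegrable_fun_norm_addHaar [Nontrivial E] {f g : ℝ → F}
    (hg : Continuous g) (h : ∀ r, 0 < r → r ^ (finrank ℝ E - 1) • f r = g r) :
    LocallyIntegrable (fun x : E ↦ f ‖x‖) μ := fun x ↦ by
  refine ⟨ball 0 (‖x‖ + 1), isOpen_ball.mem_nhds (by simp), ?_⟩
  rw [integrableOn_fun_norm_addHaar]
  exact (hg.integrableOn_Icc.mono_set Ioo_subset_Icc_self).congr_fun
    (fun r hr ↦ (h r hr.1).symm) measurableSet_Ioo

end PolarCoordinates

section RadialDerivative

variable {E F : Type*} [NormedAddCommGroup E] [NormedSpace ℝ E]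
  [NormedAddCommGroup F] [NormedSpace ℝ F] {ψ : E → F}

theorem integral_Ioi_fderiv_smul [CompleteSpace F] (hψ : ContDiff ℝ 1 ψ)
    (hc : HasCompactSupport ψ) {ω : E} (hω : ω ≠ 0) :
    ∫ r in Ioi (0 : ℝ), fderiv ℝ ψ (r • ω) ω = -ψ 0 := by
  have hderiv (r : ℝ) : HasDerivAt (fun r : ℝ ↦ ψ (r • ω)) (fderiv ℝ ψ (r • ω) ω) r :=
    (hψ.differentiable one_ne_zero (r • ω)).hasFDerivAt.comp_hasDerivAt r
      (by simpa using (hasDerivAt_id r).smul_const ω)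
  have hray : HasCompactSupport fun r : ℝ ↦ ψ (r • ω) :=
    hc.comp_isClosedEmbedding (isClosedEmbedding_smul_left hω)
  have hcont : ContDiff ℝ 1 fun r : ℝ ↦ ψ (r • ω) := hψ.comp (contDiff_id.smul contDiff_const)
  simpa only [(hderiv _).deriv, zero_smul] using hray.integral_Ioi_deriv_eq hcont 0

variable [FiniteDimensional ℝ E] [Nontrivial E] [MeasurableSpace E] [BorelSpace E]
  (μ : Measure E) [μ.IsAddHaarMeasure]

theorem integrable_radial_fderiv (hψ : ContDiff ℝ 1 ψ) (hc : HasCompactSupport ψ) :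
    Integrable (fun y ↦ (‖y‖ ^ finrank ℝ E)⁻¹ • fderiv ℝ ψ y y) μ := by
  have hloc : LocallyIntegrable (fun y : E ↦ ‖y‖ * (‖y‖ ^ finrank ℝ E)⁻¹) μ :=
    locallyIntegrable_fun_norm_addHaar μ (f := fun r ↦ r * (r ^ finrank ℝ E)⁻¹)
      (continuous_const (y := 1)) fun r hr ↦ by
        rw [smul_eq_mul, ← mul_assoc, pow_sub_one_mul finrank_pos.ne',
          mul_inv_cancel₀ (pow_pos hr _).ne']
  have hcont : Continuous (fderiv ℝ ψ) := hψ.continuous_fderiv one_ne_zero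
  refine (hloc.integrable_smul_right_of_hasCompactSupport hcont.norm (hc.fderiv ℝ).norm).mono' ?_
    (.of_forall fun y ↦ ?_)
  · have hpow : Measurable fun y : E ↦ (‖y‖ ^ finrank ℝ E)⁻¹ := by fun_prop
    exact hpow.aestronglyMeasurable.smul (hcont.clm_apply continuous_id).aestronglyMeasurable
  · calc ‖(‖y‖ ^ finrank ℝ E)⁻¹ • fderiv ℝ ψ y y‖
        = (‖y‖ ^ finrank ℝ E)⁻¹ * ‖fderiv ℝ ψ y y‖ := by simp [norm_smul]
      _ ≤ (‖y‖ ^ finrank ℝ E)⁻¹ * (‖fderiv ℝ ψ y‖ * ‖y‖) := by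
        gcongr
        exact (fderiv ℝ ψ y).le_opNorm y
      _ = _ := by rw [smul_eq_mul]; ring

theorem integral_radial_fderiv [CompleteSpace F] (hψ : ContDiff ℝ 1 ψ)
    (hc : HasCompactSupport ψ) :
    ∫ y, (‖y‖ ^ finrank ℝ E)⁻¹ • fderiv ℝ ψ y y ∂μ = -(μ.toSphere.real univ • ψ 0) := by
  have hray (ω : sphere (0 : E) 1) :
      ∫ r in Ioi (0 : ℝ), r ^ (finrank ℝ E - 1) •
        ((‖r • ω.1‖ ^ finrank ℝ E)⁻¹ • fderiv ℝ ψ (r • ω.1) (r • ω.1)) = -ψ 0 := by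
    rw [← integral_Ioi_fderiv_smul hψ hc (ne_zero_of_mem_unit_sphere ω)]
    refine setIntegral_congr_fun measurableSet_Ioi fun r (hr : 0 < r) ↦ ?_
    simp only [norm_smul, Real.norm_of_nonneg hr.le, norm_eq_of_mem_sphere, mul_one, map_smul,
      smul_smul]
    rw [mul_left_comm, pow_sub_one_mul finrank_pos.ne', inv_mul_cancel₀ (pow_pos hr _).ne',
      one_smul]
  rw [integral_eq_integral_toSphere_integral_Ioi (integrable_radial_fderiv μ hψ hc)]
  simp only [hray, integral_const, smul_neg]

end RadialDerivative

section GreenProfile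

/-- The fundamental solution of the Laplacian in dimension `n`, before division by the area of the
unit sphere, as a function of the *square* of the radius; this choice makes it smooth in the point
once a positive constant is added to its argument. -/
noncomputable def greenProfile (n : ℕ) (t : ℝ) : ℝ :=
  if n = 2 then Real.log t / 2 else -(1 / ((n : ℝ) - 2)) * t ^ ((2 - (n : ℝ)) / 2)

theorem contDiffAt_greenProfile (n : ℕ) {t : ℝ} (ht : t ≠ 0) {k : WithTop ℕ∞} :
    ContDiffAt ℝ k (greenProfile n) t := by
  unfold greenProfile
  split_ifs
  · exact (Real.contDiffAt_log.2 ht).div_const 2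
  · exact contDiffAt_const.mul (Real.contDiffAt_rpow_const_of_ne ht)

theorem hasDerivAt_greenProfile (n : ℕ) {t : ℝ} (ht : t ≠ 0) :
    HasDerivAt (greenProfile n) (t ^ (-(n : ℝ) / 2) / 2) t := by
  unfold greenProfile
  split_ifs with hn
  · refine ((Real.hasDerivAt_log ht).div_const 2).congr_deriv ?_
    rw [hn, Nat.cast_ofNat, neg_div_self two_ne_zero, Real.rpow_neg_one]
  · have hn' : (n : ℝ) - 2 ≠ 0 := sub_ne_zero.2 (by exact_mod_cast hn)
    refine ((Real.hasDerivAt_rpow_const (.inl ht)).const_mul _).congr_deriv ?_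
    rw [show (2 - (n : ℝ)) / 2 - 1 = -n / 2 by ring]
    field_simp
    ring

theorem monotoneOn_greenProfile (n : ℕ) : MonotoneOn (greenProfile n) (Ioi 0) := by
  refine monotoneOn_of_hasDerivWithinAt_nonneg (convex_Ioi 0)
    (fun t (ht : 0 < t) ↦ (hasDerivAt_greenProfile n ht.ne').continuousAt.continuousWithinAt)
    (f' := fun t ↦ t ^ (-(n : ℝ) / 2) / 2) ?_ ?_ <;> rw [interior_Ioi] <;> intro t (ht : 0 < t)
  · exact (hasDerivAt_greenProfile n ht.ne').hasDerivWithinAt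
  · positivity

theorem abs_greenProfile_add_le (n : ℕ) {t ε : ℝ} (ht : 0 < t) (hε : ε ∈ Icc (0 : ℝ) 1) :
    |greenProfile n (t + ε)| ≤ |greenProfile n t| + |greenProfile n (t + 1)| := by
  have htε : 0 < t + ε := add_pos_of_pos_of_nonneg ht hε.1
  have hmono := monotoneOn_greenProfile n
  refine (abs_le_max_abs_abs (hmono ht htε ?_) (hmono htε ?_ ?_)).trans
    (max_le_add_of_nonneg (abs_nonneg _) (abs_nonneg _))
  · linarith [hε.1]
  · exact add_pos ht one_pos
  · linarith [hε.2]

theorem tendsto_const_add_nhdsGT_zero (t : ℝ) : Tendsto (fun ε ↦ t + ε) (𝓝[>] 0) (𝓝 t) := by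
  simpa using ((continuous_const_add t).tendsto 0).mono_left nhdsWithin_le_nhds

theorem sq_rpow_neg_half {r : ℝ} (hr : 0 ≤ r) (n : ℕ) :
    (r ^ 2) ^ (-(n : ℝ) / 2) = (r ^ n)⁻¹ := by
  rw [← Real.rpow_natCast_mul hr, Nat.cast_ofNat, mul_div_cancel₀ _ two_ne_zero,
    Real.rpow_neg hr, Real.rpow_natCast]

theorem pow_mul_greenProfile_sq {n : ℕ} (hn : n ≠ 0) {r : ℝ} (hr : 0 < r) :
    r ^ (n - 1) * greenProfile n (r ^ 2) =
      if n = 2 then r * Real.log r else -(1 / ((n : ℝ) - 2)) * r := by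
  unfold greenProfile
  split_ifs with h
  · subst h
    simp [Real.log_pow]
  · have hrpow : (r ^ 2) ^ ((2 - (n : ℝ)) / 2) = r ^ (2 - (n : ℝ)) := by
      rw [← Real.rpow_natCast_mul hr.le, Nat.cast_ofNat, mul_div_cancel₀ _ two_ne_zero]
    rw [hrpow, mul_left_comm, ← Real.rpow_natCast, ← Real.rpow_add hr, Nat.cast_pred (by omega),
      show (n : ℝ) - 1 + (2 - n) = 1 by ring, Real.rpow_one]

theorem locallyIntegrable_greenProfile_norm_sq {E : Type*} [NormedAddCommGroup E]
    [NormedSpace ℝ E] [FiniteDimensional ℝ E] [Nontrivial E] [MeasurableSpace E] [BorelSpace E]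
    (μ : Measure E) [μ.IsAddHaarMeasure] :
    LocallyIntegrable (fun y : E ↦ greenProfile (finrank ℝ E) (‖y‖ ^ 2)) μ := by
  refine locallyIntegrable_fun_norm_addHaar μ (f := fun r ↦ greenProfile (finrank ℝ E) (r ^ 2))
    ?_ fun r hr ↦ pow_mul_greenProfile_sq finrank_pos.ne' hr
  split_ifs
  · exact Real.continuous_mul_log
  · exact continuous_const.mul continuous_id

end GreenProfile

theorem iteratedFDeriv_two_apply_eq_fderiv_fderiv_apply {E F : Type*} [NormedAddCommGroup E]
    [NormedSpace ℝ E] [NormedAddCommGroup F] [NormedSpace ℝ F] {f : E → F} (hf : ContDiff ℝ 2 f)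
    (x v w : E) :
    iteratedFDeriv ℝ 2 f x ![v, w] = fderiv ℝ (fun y ↦ fderiv ℝ f y w) x v := by
  have hf' : DifferentiableAt ℝ (fderiv ℝ f) x :=
    (hf.fderiv_right (m := 1) (by norm_num)).differentiable one_ne_zero x
  rw [iteratedFDeriv_two_apply, fderiv_clm_apply hf' (differentiableAt_const w)]
  simp

section Isotropic

open Laplacian InnerProductSpace Gradient

variable {E : Type*} [NormedAddCommGroup E] [InnerProductSpace ℝ E]

theorem contDiff_greenProfile_norm_sq_add (n : ℕ) {ε : ℝ} (hε : 0 < ε) {k : WithTop ℕ∞} :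
    ContDiff ℝ k fun y : E ↦ greenProfile n (‖y‖ ^ 2 + ε) :=
  contDiff_iff_contDiffAt.2 fun y ↦ (contDiffAt_greenProfile n (by positivity)).comp y
    ((contDiff_norm_sq ℝ).add contDiff_const).contDiffAt

variable [FiniteDimensional ℝ E]

theorem hasGradientAt_greenProfile_norm_sq_add (n : ℕ) {ε : ℝ} (hε : 0 < ε) (y : E) :
    HasGradientAt (fun y : E ↦ greenProfile n (‖y‖ ^ 2 + ε))
      ((‖y‖ ^ 2 + ε) ^ (-(n : ℝ) / 2) • y) y := by
  have hpos : 0 < ‖y‖ ^ 2 + ε := by positivity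
  rw [hasGradientAt_iff_hasFDerivAt]
  refine ((hasDerivAt_greenProfile n hpos.ne').comp_hasFDerivAt y
    ((hasStrictFDerivAt_norm_sq y).hasFDerivAt.add_const ε)).congr_fderiv ?_
  ext v
  simp
  ring

theorem laplacian_eq_sum_fderiv_fderiv_apply {ι F : Type*} [Fintype ι] [NormedAddCommGroup F]
    [NormedSpace ℝ F] (b : OrthonormalBasis ι ℝ E) {f : E → F} (hf : ContDiff ℝ 2 f) :
    Δ f = fun x ↦ ∑ i, fderiv ℝ (fun y ↦ fderiv ℝ f y (b i)) x (b i) := by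
  simp only [laplacian_eq_iteratedFDeriv_orthonormalBasis f b,
    iteratedFDeriv_two_apply_eq_fderiv_fderiv_apply hf]

theorem continuous_laplacian {F : Type*} [NormedAddCommGroup F] [NormedSpace ℝ F] {f : E → F}
    (hf : ContDiff ℝ 2 f) : Continuous (Δ f) := by
  rw [laplacian_eq_iteratedFDeriv_stdOrthonormalBasis]
  exact continuous_finsetSum _ fun i _ ↦ (hf.continuous_iteratedFDeriv le_rfl).eval_const _

theorem hasCompactSupport_laplacian {F : Type*} [NormedAddCommGroup F] [NormedSpace ℝ F]
    {f : E → F} (hf : HasCompactSupport f) : HasCompactSupport (Δ f) := by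
  rw [laplacian_eq_iteratedFDeriv_stdOrthonormalBasis]
  let b := stdOrthonormalBasis ℝ E
  exact (hf.iteratedFDeriv (𝕜 := ℝ) 2).comp_left
    (g := fun M : E [×2]→L[ℝ] F ↦ ∑ i, M ![b i, b i]) (by simp)

variable [MeasurableSpace E] [BorelSpace E] (μ : Measure E) [μ.IsAddHaarMeasure]

theorem integral_mul_laplacian {u ψ : E → ℝ} (hu : ContDiff ℝ 1 u) (hψ : ContDiff ℝ 2 ψ)
    (hc : HasCompactSupport ψ) :
    ∫ y, u y * Δ ψ y ∂μ = -∫ y, fderiv ℝ ψ y (∇ u y) ∂μ := by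
  let b := stdOrthonormalBasis ℝ E
  have hψ' (i) : ContDiff ℝ 1 fun y ↦ fderiv ℝ ψ y (b i) :=
    (hψ.fderiv_right (m := 1) (by norm_num)).clm_apply contDiff_const
  have hu' (i) : Continuous fun y ↦ fderiv ℝ u y (b i) :=
    (hu.continuous_fderiv one_ne_zero).clm_apply continuous_const
  have hc' (i) : HasCompactSupport fun y ↦ fderiv ℝ ψ y (b i) := hc.fderiv_apply ℝ _
  have hint (i) : Integrable (fun y ↦ u y * fderiv ℝ (fun y ↦ fderiv ℝ ψ y (b i)) y (b i)) μ :=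
    (hu.continuous.mul (((hψ' i).continuous_fderiv one_ne_zero).clm_apply
      continuous_const)).integrable_of_hasCompactSupport ((hc' i).fderiv_apply ℝ _).mul_left
  have hint' (i) : Integrable (fun y ↦ fderiv ℝ u y (b i) * fderiv ℝ ψ y (b i)) μ :=
    ((hu' i).mul (hψ' i).continuous).integrable_of_hasCompactSupport (hc' i).mul_left
  have hparts (i) : ∫ y, u y * fderiv ℝ (fun y ↦ fderiv ℝ ψ y (b i)) y (b i) ∂μ =
      -∫ y, fderiv ℝ u y (b i) * fderiv ℝ ψ y (b i) ∂μ :=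
    integral_mul_fderiv_eq_neg_fderiv_mul_of_integrable (hint' i) (hint i)
      ((hu.continuous.mul (hψ' i).continuous).integrable_of_hasCompactSupport (hc' i).mul_left)
      (fun y _ ↦ hu.differentiable one_ne_zero y) fun y _ ↦ (hψ' i).differentiable one_ne_zero y
  calc ∫ y, u y * Δ ψ y ∂μ
      = ∑ i, ∫ y, u y * fderiv ℝ (fun y ↦ fderiv ℝ ψ y (b i)) y (b i) ∂μ := by
        simp only [laplacian_eq_sum_fderiv_fderiv_apply b hψ, Finset.mul_sum]
        exact integral_finsetSum _ fun i _ ↦ hint i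
    _ = -∫ y, ∑ i, fderiv ℝ u y (b i) * fderiv ℝ ψ y (b i) ∂μ := by
        simp only [hparts, Finset.sum_neg_distrib, integral_finsetSum _ fun i _ ↦ hint' i]
    _ = -∫ y, fderiv ℝ ψ y (∇ u y) ∂μ := by
        congr 2 with y
        rw [← inner_gradient_left, real_inner_comm, ← b.sum_inner_mul_inner]
        simp only [inner_gradient_left, inner_gradient_right, conj_trivial]

variable [Nontrivial E] {ψ : E → ℝ}

theorem ae_norm_sq_pos : ∀ᵐ y ∂μ, 0 < ‖y‖ ^ 2 := by
  filter_upwards [compl_mem_ae_iff.2 (measure_singleton (0 : E))] with y (hy : y ≠ 0)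
  positivity

theorem tendsto_integral_greenProfile_norm_sq_add_mul {g : E → ℝ} (hg : Continuous g)
    (hc : HasCompactSupport g) :
    Tendsto (fun ε ↦ ∫ y, greenProfile (finrank ℝ E) (‖y‖ ^ 2 + ε) * g y ∂μ) (𝓝[>] 0)
      (𝓝 (∫ y, greenProfile (finrank ℝ E) (‖y‖ ^ 2) * g y ∂μ)) := by
  set n := finrank ℝ E
  have hcont {ε : ℝ} (hε : 0 < ε) : Continuous fun y : E ↦ greenProfile n (‖y‖ ^ 2 + ε) * g y :=
    (contDiff_greenProfile_norm_sq_add n hε (k := 0)).continuous.mul hg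
  refine tendsto_integral_filter_of_dominated_convergence
    (fun y ↦ |greenProfile n (‖y‖ ^ 2) * g y| + |greenProfile n (‖y‖ ^ 2 + 1) * g y|)
    (eventually_mem_nhdsWithin.mono fun ε hε ↦ (hcont hε).aestronglyMeasurable) ?_
    (.add (.abs ?_) (.abs ?_)) ?_
  · filter_upwards [Ioo_mem_nhdsGT one_pos] with ε hε
    filter_upwards [ae_norm_sq_pos μ] with y hy
    rw [Real.norm_eq_abs, abs_mul, abs_mul, abs_mul, ← add_mul]
    gcongr
    exact abs_greenProfile_add_le n hy (Ioo_subset_Icc_self hε)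
  · exact (locallyIntegrable_greenProfile_norm_sq μ).integrable_smul_right_of_hasCompactSupport
      hg hc
  · exact (hcont one_pos).integrable_of_hasCompactSupport hc.mul_left
  · filter_upwards [ae_norm_sq_pos μ] with y hy
    exact ((hasDerivAt_greenProfile n hy.ne').continuousAt.tendsto.comp
      (tendsto_const_add_nhdsGT_zero _)).mul_const _

theorem tendsto_integral_rpow_norm_sq_add_mul_fderiv (hψ : ContDiff ℝ 1 ψ)
    (hc : HasCompactSupport ψ) :
    Tendsto (fun ε ↦ ∫ y, (‖y‖ ^ 2 + ε) ^ (-(finrank ℝ E : ℝ) / 2) * fderiv ℝ ψ y y ∂μ) (𝓝[>] 0)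
      (𝓝 (∫ y, (‖y‖ ^ finrank ℝ E)⁻¹ * fderiv ℝ ψ y y ∂μ)) := by
  set n := finrank ℝ E
  have hexp : -(n : ℝ) / 2 ≤ 0 := by
    rw [neg_div]
    exact neg_nonpos.2 (by positivity)
  refine tendsto_integral_filter_of_dominated_convergence
    (fun y ↦ |(‖y‖ ^ n)⁻¹ * fderiv ℝ ψ y y|) ?_ ?_ (integrable_radial_fderiv μ hψ hc).abs ?_
  · filter_upwards [self_mem_nhdsWithin] with ε (hε : 0 < ε)
    have hpos (y : E) : 0 < ‖y‖ ^ 2 + ε := by positivity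
    exact (((continuous_norm.pow 2).add continuous_const).rpow_const
      fun y ↦ .inl (hpos y).ne').mul ((hψ.continuous_fderiv one_ne_zero).clm_apply
        continuous_id) |>.aestronglyMeasurable
  · filter_upwards [self_mem_nhdsWithin] with ε (hε : 0 < ε)
    filter_upwards [ae_norm_sq_pos μ] with y hy
    rw [← sq_rpow_neg_half (norm_nonneg y), Real.norm_eq_abs, abs_mul, abs_mul,
      Real.abs_rpow_of_nonneg (by positivity), abs_of_nonneg (by positivity),
      Real.abs_rpow_of_nonneg (by positivity), abs_of_nonneg hy.le]
    gcongr ?_ * _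
    exact Real.rpow_le_rpow_of_nonpos hy (le_add_of_nonneg_right hε.le) hexp
  · filter_upwards [ae_norm_sq_pos μ] with y hy
    rw [← sq_rpow_neg_half (norm_nonneg y)]
    exact ((tendsto_const_add_nhdsGT_zero _).rpow_const (.inl hy.ne')).mul_const _

theorem integral_greenProfile_norm_sq_mul_laplacian (hψ : ContDiff ℝ 2 ψ)
    (hc : HasCompactSupport ψ) :
    ∫ y, greenProfile (finrank ℝ E) (‖y‖ ^ 2) * Δ ψ y ∂μ = μ.toSphere.real univ * ψ 0 := by
  have hψ₁ : ContDiff ℝ 1 ψ := hψ.of_le one_le_two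
  have hgreen : (fun ε ↦ ∫ y, greenProfile (finrank ℝ E) (‖y‖ ^ 2 + ε) * Δ ψ y ∂μ) =ᶠ[𝓝[>] 0]
      fun ε ↦ -∫ y, (‖y‖ ^ 2 + ε) ^ (-(finrank ℝ E : ℝ) / 2) * fderiv ℝ ψ y y ∂μ := by
    filter_upwards [self_mem_nhdsWithin] with ε (hε : 0 < ε)
    rw [integral_mul_laplacian μ (contDiff_greenProfile_norm_sq_add _ hε) hψ hc]
    simp only [(hasGradientAt_greenProfile_norm_sq_add _ hε _).gradient, map_smul, smul_eq_mul]
  have hlim := (tendsto_integral_greenProfile_norm_sq_add_mul μ (continuous_laplacian hψ)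
    (hasCompactSupport_laplacian hc)).congr' hgreen
  rw [tendsto_nhds_unique hlim (tendsto_integral_rpow_norm_sq_add_mul_fderiv μ hψ₁ hc).neg]
  simpa [neg_eq_iff_eq_neg] using integral_radial_fderiv μ hψ₁ hc

end Isotropic

section AffineChangeOfVariables

variable {E F : Type*} [NormedAddCommGroup E] [NormedSpace ℝ E] [FiniteDimensional ℝ E]
  [MeasurableSpace E] [BorelSpace E] (μ : Measure E) [μ.IsAddHaarMeasure]
  [NormedAddCommGroup F] {L : E →L[ℝ] E}

theorem map_linear_add_const_addHaar (hL : L.det ≠ 0) (η : E) :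
    μ.map (fun y ↦ L y + η) = ENNReal.ofReal |L.det⁻¹| • μ := by
  calc μ.map (fun y ↦ L y + η) = (μ.map L).map (· + η) :=
        (Measure.map_map (g := (· + η)) (by fun_prop) L.continuous.measurable).symm
    _ = (ENNReal.ofReal |L.det⁻¹| • μ).map (· + η) :=
        congrArg _ (μ.map_linearMap_addHaar_eq_smul_addHaar hL)
    _ = _ := by rw [Measure.map_smul, map_add_right_eq_self]

variable {μ}

theorem locallyIntegrable_of_comp_linear_add_const (hL : L.det ≠ 0) (η : E) {f : E → F}
    (hf : LocallyIntegrable (fun y ↦ f (L y + η)) μ) : LocallyIntegrable f μ := fun x ↦ by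
  let T : E ≃ₜ E :=
    (L.toContinuousLinearEquivOfDetNeZero hL).toHomeomorph.trans (Homeomorph.addRight η)
  obtain ⟨U, hU, hi⟩ := (locallyIntegrable_map_homeomorph T).2 hf x
  have hmap : μ.map T = ENNReal.ofReal |L.det⁻¹| • μ := map_linear_add_const_addHaar μ hL η
  refine ⟨U, hU, ?_⟩
  rwa [hmap, IntegrableOn, Measure.restrict_smul,
    integrable_smul_measure (by simpa using hL) ENNReal.ofReal_ne_top] at hi

theorem integral_eq_abs_det_smul_integral_comp_linear_add_const [NormedSpace ℝ F]
    (hL : L.det ≠ 0) (η : E) (f : E → F) :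
    ∫ x, f x ∂μ = |L.det| • ∫ y, f (L y + η) ∂μ := by
  have hinj : Function.Injective fun y ↦ L y + η :=
    (add_left_injective η).comp (L.toContinuousLinearEquivOfDetNeZero hL).injective
  have hemb : MeasurableEmbedding fun y ↦ L y + η :=
    (L.continuous.add continuous_const).measurableEmbedding hinj
  rw [← hemb.integral_map, map_linear_add_const_addHaar μ hL, integral_smul_measure,
    ENNReal.toReal_ofReal (abs_nonneg _), smul_smul, ← abs_mul, mul_inv_cancel₀ hL, abs_one,
    one_smul]

end AffineChangeOfVariables

section MulTranspose

open scoped MatrixOrder in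
theorem exists_mul_transpose_eq_of_posDef {ι : Type*} [Fintype ι] [DecidableEq ι]
    {A : Matrix ι ι ℝ} (hA : A.PosDef) : ∃ C : Matrix ι ι ℝ, C.det ≠ 0 ∧ C * Cᵀ = A := by
  obtain ⟨X, hX⟩ := CStarAlgebra.nonneg_iff_eq_star_mul_self.1 hA.posSemidef.nonneg
  have hC : Xᵀ * Xᵀᵀ = A := by
    rw [hX, Matrix.star_eq_conjTranspose, Matrix.conjTranspose_eq_transpose_of_trivial,
      Matrix.transpose_transpose]
  refine ⟨Xᵀ, left_ne_zero_of_mul (b := Xᵀᵀ.det) ?_, hC⟩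
  rw [← Matrix.det_mul, hC]
  exact hA.det_pos.ne'

theorem sqrt_det_mul_transpose {ι : Type*} [Fintype ι] [DecidableEq ι] (C : Matrix ι ι ℝ) :
    √(C * Cᵀ).det = |C.det| := by
  rw [Matrix.det_mul, Matrix.det_transpose, Real.sqrt_mul_self_eq_abs]

theorem det_toEuclideanCLM {ι : Type*} [Fintype ι] [DecidableEq ι] (C : Matrix ι ι ℝ) :
    (Matrix.toEuclideanCLM (𝕜 := ℝ) C).det = C.det :=
  LinearMap.det_toLpLin 2 C

theorem toEuclideanCLM_single {ι : Type*} [Fintype ι] [DecidableEq ι] (C : Matrix ι ι ℝ) (k : ι) :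
    Matrix.toEuclideanCLM (𝕜 := ℝ) C (EuclideanSpace.single k 1) =
      ∑ i, C i k • EuclideanSpace.single i (1 : ℝ) := by
  ext i
  simp [Pi.single_apply]

variable {d : ℕ} {C : Matrix (Fin d) (Fin d) ℝ}

theorem invQuadForm_mul_transpose (hC : C.det ≠ 0) (y : EuclideanSpace ℝ (Fin d)) :
    invQuadForm (C * Cᵀ) (Matrix.toEuclideanCLM (𝕜 := ℝ) C y) = ‖y‖ ^ 2 := by
  have hCT : IsUnit Cᵀ.det := by rwa [Matrix.det_transpose, isUnit_iff_ne_zero]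
  have hcancel : Cᵀ * (C * Cᵀ)⁻¹ * C = 1 := by
    rw [Matrix.mul_inv_rev, Matrix.mul_nonsing_inv_cancel_left _ _ hCT,
      Matrix.nonsing_inv_mul _ hC.isUnit]
  rw [invQuadForm, Matrix.ofLp_toEuclideanCLM, ← Matrix.vecMul_transpose,
    ← Matrix.dotProduct_mulVec, Matrix.vecMul_transpose]
  simp only [Matrix.mulVec_mulVec, ← Matrix.mul_assoc, hcancel, Matrix.one_mulVec, dotProduct,
    EuclideanSpace.real_norm_sq_eq, ← sq]

end MulTranspose

section Anisotropic

open Laplacian InnerProductSpace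

variable {d : ℕ}

/-- The second-order operator `∇·(A∇φ) = ∑ᵢⱼ Aᵢⱼ ∂ⱼ∂ᵢφ` on twice differentiable functions, the
classical counterpart of `anisotropicLaplacian`. -/
noncomputable def divGrad (A : Matrix (Fin d) (Fin d) ℝ) (φ : EuclideanSpace ℝ (Fin d) → ℝ)
    (ξ : EuclideanSpace ℝ (Fin d)) : ℝ :=
  ∑ i, ∑ j, A i j *
    iteratedFDeriv ℝ 2 φ ξ ![EuclideanSpace.single j 1, EuclideanSpace.single i 1]

theorem laplacian_comp_toEuclideanCLM_add_const (C : Matrix (Fin d) (Fin d) ℝ)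
    {φ : EuclideanSpace ℝ (Fin d) → ℝ} (hφ : ContDiff ℝ 2 φ) (η y : EuclideanSpace ℝ (Fin d)) :
    Δ (fun y ↦ φ (Matrix.toEuclideanCLM (𝕜 := ℝ) C y + η)) y =
      divGrad (C * Cᵀ) φ (Matrix.toEuclideanCLM (𝕜 := ℝ) C y + η) := by
  set L := Matrix.toEuclideanCLM (𝕜 := ℝ) C
  let e (i : Fin d) : EuclideanSpace ℝ (Fin d) := EuclideanSpace.single i 1
  have hhess (v w) : iteratedFDeriv ℝ 2 (fun y ↦ φ (L y + η)) y ![v, w] =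
      iteratedFDeriv ℝ 2 φ (L y + η) ![L v, L w] := by
    have hshift : ContDiff ℝ 2 fun z ↦ φ (z + η) := by fun_prop
    have hchain := congrArg (· ![v, w]) (L.iteratedFDeriv_comp_right hshift y le_rfl)
    simpa [iteratedFDeriv_comp_add_right, iteratedFDeriv_two_apply, Function.comp_def] using hchain
  calc Δ (fun y ↦ φ (L y + η)) y
      = ∑ k, iteratedFDeriv ℝ 2 φ (L y + η) ![L (e k), L (e k)] := by
        simp only [laplacian_eq_iteratedFDeriv_orthonormalBasis _ (EuclideanSpace.basisFun _ ℝ),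
          hhess, EuclideanSpace.basisFun_apply, e]
    _ = ∑ k, ∑ i, ∑ j, C i k * (C j k * iteratedFDeriv ℝ 2 φ (L y + η) ![e j, e i]) := by
        simp only [iteratedFDeriv_two_apply, L, e, toEuclideanCLM_single]
        simp [Finset.mul_sum]
    _ = divGrad (C * Cᵀ) φ (L y + η) := by
        simp only [divGrad, Matrix.mul_apply, Matrix.transpose_apply, Finset.sum_mul, mul_assoc, e]
        rw [Finset.sum_comm]
        exact Finset.sum_congr rfl fun i _ ↦ Finset.sum_comm

theorem invQuadForm_nonneg {A : Matrix (Fin d) (Fin d) ℝ} (hA : A.PosSemidef)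
    (v : EuclideanSpace ℝ (Fin d)) : 0 ≤ invQuadForm A v := by
  simpa [invQuadForm] using hA.inv.dotProduct_mulVec_nonneg v.ofLp

theorem anisotropicGreen_eq {A : Matrix (Fin d) (Fin d) ℝ} (hA : A.PosSemidef)
    (ξ η : EuclideanSpace ℝ (Fin d)) :
    anisotropicGreen A ξ η =
      (unitSphereArea d * √A.det)⁻¹ * greenProfile d (invQuadForm A (ξ - η)) := by
  unfold anisotropicGreen greenProfile
  split_ifs with h
  · subst h
    rw [unitSphereArea_eq two_ne_zero, Real.log_sqrt (invQuadForm_nonneg hA _)]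
    simp
  · simp only [one_div, mul_inv]
    ring

variable {A : Matrix (Fin d) (Fin d) ℝ}

theorem locallyIntegrable_anisotropicGreen (hd : d ≠ 0) (hA : A.PosDef)
    (η : EuclideanSpace ℝ (Fin d)) : LocallyIntegrable (fun ξ ↦ anisotropicGreen A ξ η) := by
  have : NeZero d := ⟨hd⟩
  have hprofile : LocallyIntegrable fun ξ ↦ greenProfile d (invQuadForm A (ξ - η)) := by
    obtain ⟨C, hC, rfl⟩ := exists_mul_transpose_eq_of_posDef hA
    refine locallyIntegrable_of_comp_linear_add_const ((det_toEuclideanCLM C).trans_ne hC) η ?_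
    simpa [invQuadForm_mul_transpose hC] using
      locallyIntegrable_greenProfile_norm_sq (volume : Measure (EuclideanSpace ℝ (Fin d)))
  simp only [anisotropicGreen_eq hA.posSemidef]
  exact hprofile.smul (unitSphereArea d * √A.det)⁻¹

theorem integral_greenProfile_invQuadForm_mul_divGrad (hd : d ≠ 0) (hA : A.PosDef)
    {φ : EuclideanSpace ℝ (Fin d) → ℝ} (hφ : ContDiff ℝ 2 φ) (hc : HasCompactSupport φ)
    (η : EuclideanSpace ℝ (Fin d)) :
    ∫ ξ, greenProfile d (invQuadForm A (ξ - η)) * divGrad A φ ξ =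
      unitSphereArea d * √A.det * φ η := by
  have : NeZero d := ⟨hd⟩
  obtain ⟨C, hC, rfl⟩ := exists_mul_transpose_eq_of_posDef hA
  set L := Matrix.toEuclideanCLM (𝕜 := ℝ) C
  have hL : L.det ≠ 0 := (det_toEuclideanCLM C).trans_ne hC
  have hψ : ContDiff ℝ 2 fun y ↦ φ (L y + η) := by fun_prop
  have hcψ : HasCompactSupport fun y ↦ φ (L y + η) :=
    hc.comp_homeomorph
      ((L.toContinuousLinearEquivOfDetNeZero hL).toHomeomorph.trans (Homeomorph.addRight η))
  have hiso := integral_greenProfile_norm_sq_mul_laplacian volume hψ hcψ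
  rw [finrank_euclideanSpace_fin, map_zero, zero_add] at hiso
  calc ∫ ξ, greenProfile d (invQuadForm (C * Cᵀ) (ξ - η)) * divGrad (C * Cᵀ) φ ξ
      = |L.det| * ∫ y, greenProfile d (‖y‖ ^ 2) * Δ (fun y ↦ φ (L y + η)) y := by
        rw [integral_eq_abs_det_smul_integral_comp_linear_add_const hL η, smul_eq_mul]
        simp only [add_sub_cancel_right, L, invQuadForm_mul_transpose hC,
          laplacian_comp_toEuclideanCLM_add_const C hφ]
    _ = unitSphereArea d * √(C * Cᵀ).det * φ η := by
        rw [hiso, det_toEuclideanCLM, sqrt_det_mul_transpose, unitSphereArea]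
        ring

theorem integral_divGrad_mul_anisotropicGreen (hd : d ≠ 0) (hA : A.PosDef)
    {φ : EuclideanSpace ℝ (Fin d) → ℝ} (hφ : ContDiff ℝ 2 φ) (hc : HasCompactSupport φ)
    (η : EuclideanSpace ℝ (Fin d)) :
    ∫ ξ, divGrad A φ ξ * anisotropicGreen A ξ η = φ η := by
  have hω := unitSphereArea_pos hd
  have hdet : 0 < √A.det := Real.sqrt_pos.2 hA.det_pos
  simp only [anisotropicGreen_eq hA.posSemidef, mul_left_comm (divGrad A φ _), integral_const_mul,
    mul_comm (divGrad A φ _), integral_greenProfile_invQuadForm_mul_divGrad hd hA hφ hc]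
  field_simp

end Anisotropic

section Distributions

variable {d : ℕ}

theorem regularDistribution_apply {f : EuclideanSpace ℝ (Fin d) → ℝ} (hf : LocallyIntegrable f)
    (φ : 𝓓((⊤ : TopologicalSpace.Opens (EuclideanSpace ℝ (Fin d))), ℝ)) :
    regularDistribution f φ = ∫ ξ, φ ξ * f ξ :=
  TestFunction.integralAgainstBilinCLM_eq_integral (hf.locallyIntegrableOn _)

theorem sum_testFunction_apply {ι E F : Type*} [NormedAddCommGroup E] [NormedSpace ℝ E]
    [NormedAddCommGroup F] [NormedSpace ℝ F] {Ω : TopologicalSpace.Opens E} (s : Finset ι)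
    (φ : ι → 𝓓(Ω, F)) (x : E) : (∑ i ∈ s, φ i) x = ∑ i ∈ s, φ i x :=
  map_sum (AddMonoidHom.mk' (fun ψ : 𝓓(Ω, F) ↦ ψ x) fun _ _ ↦ rfl) φ s

theorem sum_distribution_apply {ι E F : Type*} [NormedAddCommGroup E] [NormedSpace ℝ E]
    [NormedAddCommGroup F] [NormedSpace ℝ F] {Ω : TopologicalSpace.Opens E} (s : Finset ι)
    (T : ι → 𝓓'(Ω, F)) (φ : 𝓓(Ω, ℝ)) : (∑ i ∈ s, T i) φ = ∑ i ∈ s, T i φ :=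
  map_sum (AddMonoidHom.mk' (fun S : 𝓓'(Ω, F) ↦ S φ) fun _ _ ↦ rfl) T s

theorem lineDerivOp_testFunction_apply {E F : Type*} [NormedAddCommGroup E] [NormedSpace ℝ E]
    [NormedAddCommGroup F] [NormedSpace ℝ F] {Ω : TopologicalSpace.Opens E} (φ : 𝓓(Ω, F))
    (w x : E) : (∂_{w} φ) x = fderiv ℝ φ x w := by
  rw [TestFunction.lineDerivOp_eq_lineDerivCLM ℝ, TestFunction.lineDerivCLM_eq_fderivCLM,
    TestFunction.fderivCLM_apply_of_le _ (by simp)]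

theorem anisotropicLaplacian_apply (A : Matrix (Fin d) (Fin d) ℝ)
    (T : 𝓓'((⊤ : TopologicalSpace.Opens (EuclideanSpace ℝ (Fin d))), ℝ))
    (φ : 𝓓((⊤ : TopologicalSpace.Opens (EuclideanSpace ℝ (Fin d))), ℝ)) :
    anisotropicLaplacian A T φ = T (∑ i, ∑ j, A i j •
      ∂_{EuclideanSpace.single j (1 : ℝ)} (∂_{EuclideanSpace.single i (1 : ℝ)} φ)) := by
  have hsmul (a : ℝ) (S : 𝓓'((⊤ : TopologicalSpace.Opens (EuclideanSpace ℝ (Fin d))), ℝ))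
    (ψ : 𝓓((⊤ : TopologicalSpace.Opens (EuclideanSpace ℝ (Fin d))), ℝ)) : (a • S) ψ = a • S ψ := rfl
  simp only [anisotropicLaplacian, sum_distribution_apply, Distribution.lineDerivOp_apply_apply,
    hsmul, LineDeriv.lineDerivOp_neg, neg_neg, map_sum, map_smul]

theorem sum_sum_smul_lineDerivOp_apply (A : Matrix (Fin d) (Fin d) ℝ)
    (φ : 𝓓((⊤ : TopologicalSpace.Opens (EuclideanSpace ℝ (Fin d))), ℝ))
    (ξ : EuclideanSpace ℝ (Fin d)) :
    (∑ i, ∑ j, A i j • ∂_{EuclideanSpace.single j (1 : ℝ)}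
      (∂_{EuclideanSpace.single i (1 : ℝ)} φ)) ξ = divGrad A φ ξ := by
  have hφ : ContDiff ℝ 2 φ := φ.contDiff.of_le (by norm_cast)
  simp only [sum_testFunction_apply, divGrad, iteratedFDeriv_two_apply_eq_fderiv_fderiv_apply hφ,
    ← lineDerivOp_testFunction_apply]
  rfl

end Distributions

-- In dimension one the power formula reads `|ξ - η| / (2 * a)` for `A = (a)`.
theorem theorem1_general (d : ℕ) (hd : d ≠ 0) (A : Matrix (Fin d) (Fin d) ℝ) (hA : A.PosDef) :
    unitSphereArea d = 2 * Real.pi ^ ((d : ℝ) / 2) / Real.Gamma ((d : ℝ) / 2) ∧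
    ∀ η : EuclideanSpace ℝ (Fin d),
      LocallyIntegrable (fun ξ => anisotropicGreen A ξ η) volume ∧
      anisotropicLaplacian A (regularDistribution (fun ξ => anisotropicGreen A ξ η)) =
        Distribution.delta η := by
  refine ⟨unitSphereArea_eq hd, fun η ↦ ?_⟩
  have hint := locallyIntegrable_anisotropicGreen hd hA η
  refine ⟨hint, ?_⟩
  ext φ
  have hφ : ContDiff ℝ 2 φ := φ.contDiff.of_le (by norm_cast)
  rw [anisotropicLaplacian_apply, regularDistribution_apply hint, Distribution.delta_apply]
  simp only [sum_sum_smul_lineDerivOp_apply]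
  exact integral_divGrad_mul_anisotropicGreen hd hA hφ φ.hasCompactSupport η

theorem theorem1 (d : ℕ) (hd : 2 ≤ d) (A : Matrix (Fin d) (Fin d) ℝ) (hA : A.PosDef) :
    unitSphereArea d = 2 * Real.pi ^ ((d : ℝ) / 2) / Real.Gamma ((d : ℝ) / 2) ∧
    ∀ η : EuclideanSpace ℝ (Fin d),
      LocallyIntegrable (fun ξ => anisotropicGreen A ξ η) volume ∧
      anisotropicLaplacian A (regularDistribution (fun ξ => anisotropicGreen A ξ η)) =
        Distribution.delta η :=
  theorem1_general d (by omega) A hA
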